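/- Let $N\ge 1$ and let $\Omega\subset\mathbb{R}^N$ be a domain (a nonempty, connected, open set, not necessarily bounded or regular) with finite Lebesgue measure, $|\Omega|<\infty$. Let $H^1(\Omega)$ be the space of real-valued $f\in \mathrm{L}^2(\Omega)$ whose weak gradient $\nabla f$ belongs to $[\mathrm{L}^2(\Omega)]^N$, with norm $(\|f\|_2^2+\|\nabla f\|_2^2)^{1/2}$, where $\|\cdot\|_p$ is the norm (quasi-norm if $p<1$) of $\mathrm{L}^p(\Omega)$. Suppose that $\Omega$ supports the Gagliardo–Nirenberg–Sobolev inequalities $$\|f\|_r\le C_S\,\big(\|\nabla f\|_2+\|f\|_2\big)^{\vartheta(s,r,N)}\,\|f\|_s^{1-\vartheta(s,r,N)}\qquad\forall f\in H^1(\Omega)\cap \mathrm{L}^s(\Omega),\qquad \vartheta(s,r,N):=\frac{2N(r-s)}{r\,[2N-s(N-2)]},$$ for all $r,s$ such that $0<s<r<\infty$ if $N\in\{1,2\}$, and for all $r,s$ such that $0<s<r\le 2^\star$ or $2^\star\le r<s<\infty$, with $2^\star:=\frac{2N}{N-2}$, if $N\ge 3$; here $C_S=C_S(s,r)>0$ does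 not depend on $f$ and is bounded as long as $r,s$ range in compact subsets of $(0,\infty)$. Then the embedding $H^1(\Omega)\hookrightarrow \mathrm{L}^2(\Omega)$ is compact, and the Poincaré inequality holds on $\Omega$: there is a constant $C_P>0$ such that $$\|f-\overline f\|_2\le C_P\,\|\nabla f\|_2\qquad\forall f\in H^1(\Omega),\qquad \overline f:=\frac{1}{|\Omega|}\int_\Omega f(x)\,dx .$$ -/

import Mathlib

open MeasureTheory
open scoped ContDiff ENNReal

noncomputable section

/-- `ℝ^N` with its Euclidean norm. -/
abbrev RN (N : ℕ) : Type := EuclideanSpace ℝ (Fin N)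

/-- A domain of `ℝ^N`: a nonempty connected open set. -/
def IsDomainOfRN {N : ℕ} (Ω : Set (RN N)) : Prop :=
  IsOpen Ω ∧ IsConnected Ω

/-- Test functions on `Ω`: smooth functions whose support is compact and contained in `Ω`. -/
def IsTestFun {N : ℕ} (Ω : Set (RN N)) (φ : RN N → ℝ) : Prop :=
  ContDiff ℝ ∞ φ ∧ HasCompactSupport φ ∧ tsupport φ ⊆ Ω

/-- The classical partial derivative `∂φ/∂x_i`. -/
def partialDeriv {N : ℕ} (i : Fin N) (φ : RN N → ℝ) (x : RN N) : ℝ :=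
  fderiv ℝ φ x (EuclideanSpace.single i 1)

/-- `g` is the weak gradient of `f` in `Ω`:
`∫_Ω f ∂_i φ = - ∫_Ω g_i φ` for all test functions `φ` and all `i`. -/
def IsWeakGradient {N : ℕ} (Ω : Set (RN N)) (f : RN N → ℝ) (g : RN N → RN N) : Prop :=
  ∀ φ : RN N → ℝ, IsTestFun Ω φ → ∀ i : Fin N,
    ∫ x in Ω, f x * partialDeriv i φ x = - ∫ x in Ω, g x i * φ x

/-- `L²(Ω)`. -/
abbrev L2 {N : ℕ} (Ω : Set (RN N)) : Type :=
  Lp ℝ 2 ((volume : Measure (RN N)).restrict Ω)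

/-- `L²(Ω; ℝ^N)`. -/
abbrev L2Vec {N : ℕ} (Ω : Set (RN N)) : Type :=
  Lp (RN N) 2 ((volume : Measure (RN N)).restrict Ω)

theorem IsTestFun.memLp {N : ℕ} {Ω : Set (RN N)} {φ : RN N → ℝ} (hφ : IsTestFun Ω φ) :
    MemLp φ 2 ((volume : Measure (RN N)).restrict Ω) :=
  (hφ.1.continuous.memLp_of_hasCompactSupport hφ.2.1).restrict Ω

theorem IsTestFun.memLp_partialDeriv {N : ℕ} {Ω : Set (RN N)} {φ : RN N → ℝ}
    (hφ : IsTestFun Ω φ) (i : Fin N) :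
    MemLp (partialDeriv i φ) 2 ((volume : Measure (RN N)).restrict Ω) := by
  have hc : Continuous (partialDeriv i φ) :=
    (hφ.1.continuous_fderiv (by simp)).clm_apply continuous_const
  have hs : HasCompactSupport (partialDeriv i φ) := hφ.2.1.fderiv_apply ℝ _
  exact (hc.memLp_of_hasCompactSupport hs).restrict Ω

theorem memLp_coord {N : ℕ} {Ω : Set (RN N)} (g : L2Vec Ω) (i : Fin N) :
    MemLp (fun x => g x i) 2 ((volume : Measure (RN N)).restrict Ω) :=
  (Lp.memLp g).continuousLinearMap_comp (EuclideanSpace.proj (𝕜 := ℝ) i)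

/-- The Sobolev space `H¹(Ω)`: the functions `f ∈ L²(Ω)` that have a weak gradient
`g ∈ L²(Ω; ℝ^N)`. An element is stored as the pair `(f, g)`, where `g` is determined by `f`
when `Ω` is open; the norm is `(‖f‖₂² + ‖∇f‖₂²)^{1/2}`. -/
def H1 {N : ℕ} (Ω : Set (RN N)) : Submodule ℝ (WithLp 2 (L2 Ω × L2Vec Ω)) where
  carrier := {p | IsWeakGradient Ω (p.fst : RN N → ℝ) (p.snd : RN N → RN N)}
  zero_mem' := by
    intro φ _ i
    have h1 : ∫ x in Ω, (0 : L2 Ω) x * partialDeriv i φ x = 0 := by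
      refine integral_eq_zero_of_ae ?_
      filter_upwards [Lp.coeFn_zero ℝ 2 ((volume : Measure (RN N)).restrict Ω)] with x hx
      rw [hx]
      simp
    have h2 : ∫ x in Ω, (0 : L2Vec Ω) x i * φ x = 0 := by
      refine integral_eq_zero_of_ae ?_
      filter_upwards [Lp.coeFn_zero (RN N) 2 ((volume : Measure (RN N)).restrict Ω)] with x hx
      rw [hx]
      simp
    change ∫ x in Ω, (0 : L2 Ω) x * partialDeriv i φ x
      = - ∫ x in Ω, (0 : L2Vec Ω) x i * φ x
    rw [h1, h2, neg_zero]
  add_mem' := by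
    intro p q hp hq φ hφ i
    have h1 : ∫ x in Ω, (p.fst + q.fst : L2 Ω) x * partialDeriv i φ x
        = (∫ x in Ω, p.fst x * partialDeriv i φ x)
          + ∫ x in Ω, q.fst x * partialDeriv i φ x := by
      refine Eq.trans ?_ (integral_add ((Lp.memLp p.fst).integrable_mul (hφ.memLp_partialDeriv i))
        ((Lp.memLp q.fst).integrable_mul (hφ.memLp_partialDeriv i)))
      refine integral_congr_ae ?_
      filter_upwards [Lp.coeFn_add p.fst q.fst] with x hx
      rw [hx]
      simp [add_mul]
    have h2 : ∫ x in Ω, (p.snd + q.snd : L2Vec Ω) x i * φ x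
        = (∫ x in Ω, p.snd x i * φ x) + ∫ x in Ω, q.snd x i * φ x := by
      refine Eq.trans ?_ (integral_add ((memLp_coord p.snd i).integrable_mul hφ.memLp)
        ((memLp_coord q.snd i).integrable_mul hφ.memLp))
      refine integral_congr_ae ?_
      filter_upwards [Lp.coeFn_add p.snd q.snd] with x hx
      rw [hx]
      simp [add_mul]
    have hp' := hp φ hφ i
    have hq' := hq φ hφ i
    change ∫ x in Ω, (p.fst + q.fst : L2 Ω) x * partialDeriv i φ x
      = - ∫ x in Ω, (p.snd + q.snd : L2Vec Ω) x i * φ x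
    rw [h1, h2, hp', hq']
    ring
  smul_mem' := by
    intro c p hp φ hφ i
    have h1 : ∫ x in Ω, (c • p.fst : L2 Ω) x * partialDeriv i φ x
        = c * ∫ x in Ω, p.fst x * partialDeriv i φ x := by
      rw [← integral_const_mul]
      refine integral_congr_ae ?_
      filter_upwards [Lp.coeFn_smul c p.fst] with x hx
      simp [hx, mul_assoc]
    have h2 : ∫ x in Ω, (c • p.snd : L2Vec Ω) x i * φ x
        = c * ∫ x in Ω, p.snd x i * φ x := by
      rw [← integral_const_mul]
      refine integral_congr_ae ?_
      filter_upwards [Lp.coeFn_smul c p.snd] with x hx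
      simp [hx, mul_assoc]
    have hp' := hp φ hφ i
    change ∫ x in Ω, (c • p.fst : L2 Ω) x * partialDeriv i φ x
      = - ∫ x in Ω, (c • p.snd : L2Vec Ω) x i * φ x
    rw [h1, h2, hp']
    ring

/-- The inclusion `H¹(Ω) → L²(Ω)`. -/
def H1.toL2 {N : ℕ} (Ω : Set (RN N)) : H1 Ω →L[ℝ] L2 Ω :=
  (WithLp.fstL 2 ℝ (L2 Ω) (L2Vec Ω)).comp (H1 Ω).subtypeL

/-- The weak gradient `H¹(Ω) → L²(Ω; ℝ^N)`. -/
def H1.grad {N : ℕ} (Ω : Set (RN N)) : H1 Ω →L[ℝ] L2Vec Ω :=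
  (WithLp.sndL 2 ℝ (L2 Ω) (L2Vec Ω)).comp (H1 Ω).subtypeL

/-- The (quasi-)norm `‖f‖_p` on `Ω` for `0 < p < ∞`, with value `∞` if `f ∉ L^p(Ω)`. -/
def normOn {N : ℕ} (Ω : Set (RN N)) (p : ℝ) (f : RN N → ℝ) : ℝ≥0∞ :=
  eLpNorm f (ENNReal.ofReal p) ((volume : Measure (RN N)).restrict Ω)

/-- The critical Sobolev exponent `2N/(N-2)`, used only for `N ≥ 3`. -/
def sobolevExponent (N : ℕ) : ℝ := 2 * (N : ℝ) / ((N : ℝ) - 2)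

/-- The interpolation exponent `ϑ(s,r,N) = 2N(r-s) / (r[2N-s(N-2)])`. -/
def gnsTheta (s r : ℝ) (N : ℕ) : ℝ :=
  2 * (N : ℝ) * (r - s) / (r * (2 * (N : ℝ) - s * ((N : ℝ) - 2)))

/-- The admissible pairs `(s,r)`: `0 < s < r < ∞` if `N ≤ 2`, and
`0 < s < r ≤ 2N/(N-2)` or `2N/(N-2) ≤ r < s < ∞` if `N ≥ 3`. -/
def GNSAdmissible (N : ℕ) (s r : ℝ) : Prop :=
  (N ≤ 2 ∧ 0 < s ∧ s < r) ∨
  (3 ≤ N ∧ ((0 < s ∧ s < r ∧ r ≤ sobolevExponent N) ∨ (sobolevExponent N ≤ r ∧ r < s)))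

/-- `Ω` supports the Gagliardo-Nirenberg-Sobolev inequalities: for all admissible `(s,r)`,
`‖f‖_r ≤ C_S (‖∇f‖₂ + ‖f‖₂)^ϑ ‖f‖_s^{1-ϑ}` for all `f ∈ H¹(Ω) ∩ L^s(Ω)`,
where `C_S = C_S(s,r) > 0` is bounded as long as `s, r` range in compact subsets of `(0,∞)`. -/
def SupportsGNS {N : ℕ} (Ω : Set (RN N)) : Prop :=
  ∃ C_S : ℝ → ℝ → ℝ,
    (∀ K : Set ℝ, IsCompact K → K ⊆ Set.Ioi 0 →
      ∃ M : ℝ, ∀ s ∈ K, ∀ r ∈ K, GNSAdmissible N s r → C_S s r ≤ M) ∧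
    ∀ s r : ℝ, GNSAdmissible N s r → 0 < C_S s r ∧
      ∀ f : H1 Ω, normOn Ω s (H1.toL2 Ω f) < ⊤ →
        normOn Ω r (H1.toL2 Ω f) ≤
          ENNReal.ofReal (C_S s r)
            * ENNReal.ofReal (‖H1.grad Ω f‖ + ‖H1.toL2 Ω f‖) ^ gnsTheta s r N
            * normOn Ω s (H1.toL2 Ω f) ^ (1 - gnsTheta s r N)

/-- The mean value `(∫_Ω f) / |Ω|`. -/
def meanOn {N : ℕ} (Ω : Set (RN N)) (f : RN N → ℝ) : ℝ :=
  (∫ x in Ω, f x) / (volume : Measure (RN N)).real Ω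

/-- The Poincaré inequality on `Ω`: for some `C_P > 0`,
`‖f - f̄‖₂ ≤ C_P ‖∇f‖₂` for all `f ∈ H¹(Ω)`. -/
def SupportsPoincare {N : ℕ} (Ω : Set (RN N)) : Prop :=
  ∃ C_P : ℝ, 0 < C_P ∧ ∀ f : H1 Ω,
    normOn Ω 2 (fun x => H1.toL2 Ω f x - meanOn Ω (H1.toL2 Ω f))
      ≤ ENNReal.ofReal (C_P * ‖H1.grad Ω f‖)

end

/-! With `s = 2`, the Gagliardo–Nirenberg–Sobolev inequality bounds `‖f‖_q` by the `H¹` norm for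
some `q > 2`. This higher integrability replaces regularity of the boundary: by Hölder, the `L²`
mass of `f` in the layer within distance `2δ` of the complement is at most a constant times
`‖f‖_{H¹}` times a positive power of the measure of the layer, which tends to `0` because `|Ω| < ∞`.
Away from the layer, mollification at scale `δ` moves `f` by at most `δ ‖∇f‖₂`
(`lintegral_mollify_sub_le`).

The operator `f ↦ 1_S (φ_δ ⋆ f)`, with `S` the complement of the layer, has a square integrable
kernel and is therefore compact (`isCompactOperator_kernelOperator`). By
`norm_toL2_sub_mollifyOperator_le` these operators, composed with the inclusion `H¹ → L²`, converge
to it in operator norm as `δ → 0`, so the inclusion is compact.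

Poincaré follows by contradiction: normalized mean-zero functions with gradients tending to `0` have
an `L²` limit of norm one, mean zero and zero weak gradient. Connectedness makes this limit
constant, hence zero. -/

/-! ### Mean squares of averages -/

theorem sq_lintegral_le_lintegral_sq {α : Type*} [MeasurableSpace α] {ν : Measure α}
    [IsProbabilityMeasure ν] {h : α → ℝ≥0∞} (hm : AEMeasurable h ν) :
    (∫⁻ a, h a ∂ν) ^ 2 ≤ ∫⁻ a, h a ^ 2 ∂ν := by
  have h1 := ENNReal.lintegral_mul_le_Lp_mul_Lq ν (p := 2) (q := 2)
    Real.HolderConjugate.two_two hm (aemeasurable_const (b := (1 : ℝ≥0∞)))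
  simp only [Pi.mul_apply, mul_one, lintegral_const, measure_univ,
    ENNReal.rpow_two, one_pow, ENNReal.one_rpow] at h1
  calc (∫⁻ a, h a ∂ν) ^ 2 ≤ ((∫⁻ a, h a ^ 2 ∂ν) ^ (1 / (2 : ℝ))) ^ 2 := by gcongr
    _ = ∫⁻ a, h a ^ 2 ∂ν := by
      rw [← ENNReal.rpow_two, ← ENNReal.rpow_mul]; norm_num

/-- The mean square of an average is at most the average of the mean squares. -/
theorem lintegral_sq_lintegral_le {α β : Type*} [MeasurableSpace α] [MeasurableSpace β]
    {μ : Measure α} [SFinite μ] {ν : Measure β} [IsProbabilityMeasure ν] {h : α → β → ℝ≥0∞}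
    (hm : Measurable (Function.uncurry h)) {M : ℝ≥0∞}
    (hM : ∀ᵐ b ∂ν, ∫⁻ a, h a b ^ 2 ∂μ ≤ M) :
    ∫⁻ a, (∫⁻ b, h a b ∂ν) ^ 2 ∂μ ≤ M := by
  calc ∫⁻ a, (∫⁻ b, h a b ∂ν) ^ 2 ∂μ ≤ ∫⁻ a, ∫⁻ b, h a b ^ 2 ∂ν ∂μ :=
        lintegral_mono fun a => sq_lintegral_le_lintegral_sq
          (hm.comp measurable_prodMk_left).aemeasurable
    _ = ∫⁻ b, ∫⁻ a, h a b ^ 2 ∂μ ∂ν := lintegral_lintegral_swap (hm.pow_const 2).aemeasurable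
    _ ≤ ∫⁻ _, M ∂ν := lintegral_mono_ae hM
    _ = M := by simp

/-! ### Compactness of operators with square integrable kernel -/

/-- The operator `v ↦ (x ↦ ⟪v, K x⟫)` from `E` to `L²(μ)` defined by a square integrable field `K`
of vectors. -/
noncomputable def kernelOperator {α : Type*} [MeasurableSpace α] (μ : Measure α)
    (E : Type*) [NormedAddCommGroup E] [InnerProductSpace ℝ E] :
    Lp E 2 μ →L[ℝ] E →L[ℝ] Lp ℝ 2 μ :=
  ((innerSL ℝ : E →L[ℝ] E →L[ℝ] ℝ).compLpL₂ 2 μ).flip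

theorem coeFn_kernelOperator {α : Type*} [MeasurableSpace α] {μ : Measure α}
    {E : Type*} [NormedAddCommGroup E] [InnerProductSpace ℝ E] (K : Lp E 2 μ) (v : E) :
    kernelOperator μ E K v =ᵐ[μ] fun x => inner ℝ v (K x) :=
  ContinuousLinearMap.coeFn_compLp (innerSL ℝ v) K

/-- An indicator field `1_s c` gives the rank-one operator `v ↦ ⟪c, v⟫ 1_s`. Sums of compact
operators are compact, the operator depends continuously on `K`, and compact operators are norm
closed, so density of simple functions in `L²` covers every `K`. -/
theorem isCompactOperator_kernelOperator {α : Type*} [MeasurableSpace α] {μ : Measure α}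
    {E : Type*} [NormedAddCommGroup E] [InnerProductSpace ℝ E] (K : Lp E 2 μ) :
    IsCompactOperator (kernelOperator μ E K) := by
  refine Lp.induction (by simp) (motive := fun K => IsCompactOperator (kernelOperator μ E K))
    ?_ ?_ ?_ K
  · intro c s hs hμs
    have h : (kernelOperator μ E (Lp.simpleFunc.indicatorConst 2 hs hμs.ne c) : E → Lp ℝ 2 μ) =
        (ContinuousLinearMap.toSpanSingleton ℝ (indicatorConstLp 2 hs hμs.ne (1 : ℝ))) ∘ innerSL ℝ c := by
      funext v
      refine Lp.ext ?_
      rw [Lp.simpleFunc.coe_indicatorConst]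
      filter_upwards [coeFn_kernelOperator (indicatorConstLp 2 hs hμs.ne c) v,
        indicatorConstLp_coeFn (p := 2) (hs := hs) (hμs := hμs.ne) (c := c),
        indicatorConstLp_coeFn (p := 2) (hs := hs) (hμs := hμs.ne) (c := (1 : ℝ)),
        Lp.coeFn_smul (innerSL ℝ c v) (indicatorConstLp 2 hs hμs.ne (1 : ℝ))] with x h1 h2 h3 h4
      rw [h1, h2]
      simp only [Function.comp_apply, ContinuousLinearMap.toSpanSingleton_apply]
      rw [h4]
      simp only [Pi.smul_apply, h3]
      by_cases hx : x ∈ s <;> simp [hx, real_inner_comm]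
    rw [h]
    exact (isCompactOperator_of_locallyCompactSpace_dom (innerSL ℝ c)).clm_comp _
  · intro f g hf hg _ h1 h2
    rw [map_add]
    exact h1.add h2
  · exact isClosed_setOfPred_isCompactOperator.preimage (kernelOperator μ E).continuous

/-! ### From Gagliardo–Nirenberg–Sobolev to an `L^q` embedding -/

theorem normOn_two_coeFn {N : ℕ} {Ω : Set (RN N)} (f : L2 Ω) :
    normOn Ω 2 f = ENNReal.ofReal ‖f‖ := by
  rw [normOn, Lp.norm_def, ENNReal.ofReal_toReal (Lp.eLpNorm_ne_top f)]
  norm_num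

theorem H1.norm_toL2_le {N : ℕ} {Ω : Set (RN N)} (f : H1 Ω) : ‖H1.toL2 Ω f‖ ≤ ‖f‖ :=
  WithLp.norm_fst_le _ (f : WithLp 2 (L2 Ω × L2Vec Ω))

theorem H1.norm_grad_le {N : ℕ} {Ω : Set (RN N)} (f : H1 Ω) : ‖H1.grad Ω f‖ ≤ ‖f‖ :=
  WithLp.norm_snd_le _ (f : WithLp 2 (L2 Ω × L2Vec Ω))

/-- For `s = 2` the exponent is `ϑ = N(q-2)/(2q)`: it equals `N/4` for `q = 4`, and `1` at the
critical exponent. Both `ϑ` and `1 - ϑ` must be nonnegative for each factor to be bounded by a power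
of the `H¹` norm. -/
theorem exists_gnsAdmissible_two {N : ℕ} (hN : 1 ≤ N) :
    ∃ q : ℝ, 2 < q ∧ GNSAdmissible N 2 q ∧ 0 ≤ gnsTheta 2 q N ∧ gnsTheta 2 q N ≤ 1 := by
  by_cases h : N ≤ 2
  · refine ⟨4, by norm_num, Or.inl ⟨h, by norm_num, by norm_num⟩, ?_⟩
    interval_cases N <;> norm_num [gnsTheta]
  · have h3 : (3 : ℝ) ≤ N := by exact_mod_cast (not_le.mp h)
    have h0 : 0 < (N : ℝ) - 2 := by linarith
    have h2 : 2 < sobolevExponent N := by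
      rw [sobolevExponent, lt_div_iff₀ h0]; linarith
    have h1 : gnsTheta 2 (sobolevExponent N) N = 1 := by
      rw [gnsTheta, sobolevExponent]
      have : (N : ℝ) ≠ 0 := by linarith
      field_simp
    exact ⟨_, h2, Or.inr ⟨by omega, Or.inl ⟨by norm_num, h2, le_rfl⟩⟩, by rw [h1]; norm_num,
      h1.le⟩

/-- The Gagliardo-Nirenberg-Sobolev inequalities embed `H¹` into some `L^q` with `q > 2`. -/
theorem SupportsGNS.exists_embedding {N : ℕ} (hN : 1 ≤ N) {Ω : Set (RN N)} (h : SupportsGNS Ω) :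
    ∃ q C : ℝ, 2 < q ∧ 0 ≤ C ∧ ∀ f : H1 Ω, normOn Ω q (H1.toL2 Ω f) ≤ ENNReal.ofReal (C * ‖f‖) := by
  obtain ⟨q, hq, hadm, hθ0, hθ1⟩ := exists_gnsAdmissible_two hN
  obtain ⟨C, -, hC⟩ := h
  obtain ⟨hpos, hC⟩ := hC 2 q hadm
  refine ⟨q, C 2 q * 2, hq, by positivity, fun f => ?_⟩
  have hle : ‖H1.grad Ω f‖ + ‖H1.toL2 Ω f‖ ≤ 2 * ‖f‖ := by
    linarith [H1.norm_toL2_le f, H1.norm_grad_le f]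
  refine (hC f (by rw [normOn_two_coeFn]; exact ENNReal.ofReal_lt_top)).trans ?_
  rw [normOn_two_coeFn, mul_assoc (C 2 q), ENNReal.ofReal_mul hpos.le, mul_assoc]
  gcongr
  -- Each base is at most `2‖f‖` and the two exponents add up to `1`.
  calc _ ≤ ENNReal.ofReal (2 * ‖f‖) ^ gnsTheta 2 q N
          * ENNReal.ofReal (2 * ‖f‖) ^ (1 - gnsTheta 2 q N) := by
        have : 0 ≤ 1 - gnsTheta 2 q N := by linarith
        gcongr
        linarith [norm_nonneg (H1.grad Ω f)]
    _ = ENNReal.ofReal (2 * ‖f‖) := by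
        rw [← ENNReal.rpow_add_of_nonneg _ _ hθ0 (by linarith)]; simp

/-! ### Mollification and weak gradients -/

open scoped Convolution

/-- The convolution of `F` with the normalized bump function `φ`. -/
noncomputable def mollify {N : ℕ} (φ : ContDiffBump (0 : RN N)) (F : RN N → ℝ) : RN N → ℝ :=
  φ.normed volume ⋆[ContinuousLinearMap.lsmul ℝ ℝ, volume] F

theorem mollify_apply {N : ℕ} (φ : ContDiffBump (0 : RN N)) (F : RN N → ℝ) (x : RN N) :
    mollify φ F x = ∫ w, φ.normed volume w * F (x - w) := rfl

theorem mollify_apply_swap {N : ℕ} (φ : ContDiffBump (0 : RN N)) (F : RN N → ℝ) (x : RN N) :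
    mollify φ F x = ∫ y, φ.normed volume (x - y) * F y := by
  rw [mollify, convolution_eq_swap]; rfl

theorem contDiff_mollify {N : ℕ} (φ : ContDiffBump (0 : RN N)) {F : RN N → ℝ}
    (hF : LocallyIntegrable F) : ContDiff ℝ 1 (mollify φ F) :=
  φ.hasCompactSupport_normed.contDiff_convolution_left _ (φ.contDiff_normed (n := 1)) hF

theorem isTestFun_normed_sub {N : ℕ} {Ω : Set (RN N)} (φ : ContDiffBump (0 : RN N)) {x : RN N}
    (hx : Metric.closedBall x φ.rOut ⊆ Ω) : IsTestFun Ω fun y => φ.normed volume (x - y) := by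
  have hs : Function.support (fun y => φ.normed volume (x - y)) ⊆ Metric.closedBall x φ.rOut := by
    intro y hy
    have : x - y ∈ Function.support (φ.normed volume) := hy
    rw [φ.support_normed_eq] at this
    rw [Metric.mem_closedBall, dist_comm, dist_eq_norm]
    simpa using (mem_ball_zero_iff.mp this).le
  have hts := closure_minimal hs Metric.isClosed_closedBall
  exact ⟨φ.contDiff_normed.comp (contDiff_const.sub contDiff_id),
    (isCompact_closedBall x φ.rOut).of_isClosed_subset (isClosed_tsupport _) hts, hts.trans hx⟩

/-- The gradient of a mollified function is the mollified weak gradient. -/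
theorem fderiv_mollify_apply {N : ℕ} {Ω : Set (RN N)} (hΩ : MeasurableSet Ω)
    (φ : ContDiffBump (0 : RN N)) {f : L2 Ω} {g : L2Vec Ω} (hw : IsWeakGradient Ω f g)
    (hF : LocallyIntegrable (Ω.indicator f)) {x : RN N}
    (hx : Metric.closedBall x φ.rOut ⊆ Ω) (z : RN N) :
    fderiv ℝ (mollify φ (Ω.indicator f)) x z
      = ∫ w, φ.normed volume w * inner ℝ z (Ω.indicator g (x - w)) := by
  set ψ : RN N → ℝ := φ.normed volume with hψ
  have hψs : ContDiff ℝ ∞ ψ := φ.contDiff_normed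
  have htest : IsTestFun Ω (fun y => ψ (x - y)) := isTestFun_normed_sub φ hx
  have hpd : ∀ i y, partialDeriv i (fun y => ψ (x - y)) y
      = - fderiv ℝ ψ (x - y) (EuclideanSpace.single i 1) := by
    intro i y
    have h1 : HasFDerivAt (fun y => x - y) (-(ContinuousLinearMap.id ℝ (RN N))) y :=
      (hasFDerivAt_id y).const_sub x
    have h2 := ((hψs.differentiable (by simp)) (x - y)).hasFDerivAt.comp y h1
    have h3 : fderiv ℝ (fun y => ψ (x - y)) y
        = (fderiv ℝ ψ (x - y)).comp (-(ContinuousLinearMap.id ℝ (RN N))) := h2.fderiv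
    simp [partialDeriv, h3]
  have hz : z = ∑ i, z i • EuclideanSpace.single i (1 : ℝ) := by
    ext j
    simp [Finset.sum_apply, Pi.single_apply]
  -- The sign from differentiating `y ↦ x - y` cancels the sign in the definition of the weak
  -- gradient.
  have hL : ∀ i, ∫ y in Ω, f y * fderiv ℝ ψ (x - y) (EuclideanSpace.single i 1)
      = ∫ y in Ω, g y i * ψ (x - y) := by
    intro i
    have := hw _ htest i
    simp only [hpd, mul_neg, integral_neg, neg_inj] at this
    exact this
  have hint1 : ∀ i, Integrable (fun y => f y * fderiv ℝ ψ (x - y) (EuclideanSpace.single i 1))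
      (volume.restrict Ω) := by
    intro i
    have := ((Lp.memLp f).integrable_mul (htest.memLp_partialDeriv i)).neg
    refine this.congr (Filter.Eventually.of_forall fun y => ?_)
    simp [hpd]
  have hint2 : ∀ i, Integrable (fun y => g y i * ψ (x - y)) (volume.restrict Ω) :=
    fun i => (memLp_coord g i).integrable_mul htest.memLp
  have hder : fderiv ℝ (mollify φ (Ω.indicator f)) x
      = (fderiv ℝ ψ ⋆[(ContinuousLinearMap.lsmul ℝ ℝ).precompL (RN N), volume]
          (Ω.indicator f)) x :=
    (φ.hasCompactSupport_normed.hasFDerivAt_convolution_left _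
      (φ.contDiff_normed (n := 1)) hF x).fderiv
  have hex := (φ.hasCompactSupport_normed (μ := volume)).fderiv ℝ |>.convolutionExists_left
    ((ContinuousLinearMap.lsmul ℝ ℝ).precompL (RN N)) (hψs.continuous_fderiv (by simp)) hF x
  rw [hder, convolution_def, ContinuousLinearMap.integral_apply hex]
  calc ∫ t, ((ContinuousLinearMap.lsmul ℝ ℝ).precompL (RN N) (fderiv ℝ ψ t)
        (Ω.indicator f (x - t))) z
      = ∫ t, fderiv ℝ ψ t z * Ω.indicator f (x - t) := by
        refine integral_congr_ae (Filter.Eventually.of_forall fun t => ?_)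
        simp [ContinuousLinearMap.precompL_apply]
    _ = ∫ y, fderiv ℝ ψ (x - y) z * Ω.indicator f y := by
        rw [← integral_sub_left_eq_self _ volume x]; simp
    _ = ∫ y in Ω, f y * fderiv ℝ ψ (x - y) z := by
        rw [← integral_indicator hΩ]
        refine integral_congr_ae (Filter.Eventually.of_forall fun y => ?_)
        by_cases hy : y ∈ Ω <;> simp [hy, mul_comm]
    _ = ∫ y in Ω, ∑ i, z i * (f y * fderiv ℝ ψ (x - y) (EuclideanSpace.single i 1)) := by
        refine integral_congr_ae (Filter.Eventually.of_forall fun y => ?_)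
        conv_lhs => rw [hz]
        simp only [map_sum, map_smul, smul_eq_mul, Finset.mul_sum]
        exact Finset.sum_congr rfl fun i _ => by ring
    _ = ∑ i, z i * ∫ y in Ω, g y i * ψ (x - y) := by
        rw [integral_finsetSum _ fun i _ => (hint1 i).const_mul _]
        simp only [integral_const_mul, hL]
    _ = ∫ y in Ω, ψ (x - y) * inner ℝ z (g y) := by
        simp only [← integral_const_mul]
        rw [← integral_finsetSum _ fun i _ => (hint2 i).const_mul _]
        refine integral_congr_ae (Filter.Eventually.of_forall fun y => ?_)
        simp only [PiLp.inner_apply, Finset.mul_sum]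
        exact Finset.sum_congr rfl fun i _ => by simp; ring
    _ = ∫ y, ψ (x - y) * inner ℝ z (Ω.indicator g y) := by
        rw [← integral_indicator hΩ]
        refine integral_congr_ae (Filter.Eventually.of_forall fun y => ?_)
        by_cases hy : y ∈ Ω <;> simp [hy]
    _ = ∫ w, ψ w * inner ℝ z (Ω.indicator g (x - w)) := by
        rw [← integral_sub_left_eq_self _ volume x]; simp

/-! ### `L²` estimates for translation and mollification -/

/-- The points of `Ω` whose distance to the complement of `Ω` exceeds `δ`. -/
def innerSet {N : ℕ} (Ω : Set (RN N)) (δ : ℝ) : Set (RN N) := (Metric.cthickening δ Ωᶜ)ᶜ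

theorem isOpen_innerSet {N : ℕ} (Ω : Set (RN N)) (δ : ℝ) : IsOpen (innerSet Ω δ) :=
  Metric.isClosed_cthickening.isOpen_compl

theorem closedBall_subset_of_mem_innerSet {N : ℕ} {Ω : Set (RN N)} {δ : ℝ} {x : RN N}
    (hx : x ∈ innerSet Ω δ) : Metric.closedBall x δ ⊆ Ω := by
  intro y hy
  by_contra h
  exact hx (Metric.mem_cthickening_of_dist_le x y δ _ h (by rwa [dist_comm]))

theorem innerSet_subset {N : ℕ} (Ω : Set (RN N)) (δ : ℝ) : innerSet Ω δ ⊆ Ω :=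
  Set.compl_subset_comm.mp (Metric.self_subset_cthickening _)

/-- The bump function with radii `δ / 2` and `δ`. -/
noncomputable def radialBump (N : ℕ) {δ : ℝ} (hδ : 0 < δ) : ContDiffBump (0 : RN N) where
  rIn := δ / 2
  rOut := δ
  rIn_pos := by positivity
  rIn_lt_rOut := by linarith

/-- The probability measure whose density is the normalized bump function. -/
noncomputable def bumpMeasure {N : ℕ} (φ : ContDiffBump (0 : RN N)) : Measure (RN N) :=
  volume.withDensity fun w => ENNReal.ofReal (φ.normed volume w)

theorem measurable_ofReal_normed {N : ℕ} (φ : ContDiffBump (0 : RN N)) :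
    Measurable fun w => ENNReal.ofReal (φ.normed volume w) :=
  φ.continuous_normed.measurable.ennreal_ofReal

instance isProbabilityMeasure_bumpMeasure {N : ℕ} (φ : ContDiffBump (0 : RN N)) :
    IsProbabilityMeasure (bumpMeasure φ) where
  measure_univ := by
    rw [bumpMeasure, withDensity_apply _ MeasurableSet.univ, Measure.restrict_univ,
      ← ofReal_integral_eq_lintegral_ofReal φ.integrable_normed
        (Filter.Eventually.of_forall φ.nonneg_normed), φ.integral_normed, ENNReal.ofReal_one]

theorem ae_bumpMeasure_norm_le {N : ℕ} (φ : ContDiffBump (0 : RN N)) :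
    ∀ᵐ w ∂bumpMeasure φ, ‖w‖ ≤ φ.rOut := by
  rw [bumpMeasure, ae_withDensity_iff (measurable_ofReal_normed φ)]
  refine Filter.Eventually.of_forall fun w hw => ?_
  have : w ∈ Function.support (φ.normed volume) := fun h => hw (by simp [h])
  rw [φ.support_normed_eq] at this
  exact (mem_ball_zero_iff.mp this).le

/-- Turns convolution bounds into averages over a probability measure, to which
`lintegral_sq_lintegral_le` applies. -/
theorem enorm_integral_normed_mul_le {N : ℕ} (φ : ContDiffBump (0 : RN N)) {h : RN N → ℝ}
    (hm : Measurable h) :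
    ‖∫ w, φ.normed volume w * h w‖ₑ ≤ ∫⁻ w, ‖h w‖ₑ ∂bumpMeasure φ := by
  refine (enorm_integral_le_lintegral_enorm _).trans (le_of_eq ?_)
  rw [bumpMeasure, lintegral_withDensity_eq_lintegral_mul _ (measurable_ofReal_normed φ) hm.enorm]
  refine lintegral_congr fun w => ?_
  simp [enorm_mul, Real.enorm_of_nonneg (φ.nonneg_normed w)]

theorem lintegral_enorm_sq_coeFn {α E : Type*} [MeasurableSpace α] {μ : Measure α}
    [NormedAddCommGroup E] (h : Lp E 2 μ) : ∫⁻ x, ‖h x‖ₑ ^ 2 ∂μ = ‖h‖ₑ ^ 2 := by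
  have := eLpNorm_nnreal_pow_eq_lintegral (f := h) (μ := μ) (p := 2) (by norm_num)
  rw [Lp.enorm_def]
  norm_num at this
  exact this.symm

theorem measurable_indicator_coeFn {N : ℕ} {Ω : Set (RN N)} (hΩ : MeasurableSet Ω) {E : Type*}
    [NormedAddCommGroup E] [MeasurableSpace E] [BorelSpace E]
    (h : Lp E 2 ((volume : Measure (RN N)).restrict Ω)) : Measurable (Ω.indicator h) :=
  (Lp.stronglyMeasurable h).measurable.indicator hΩ

theorem lintegral_enorm_sq_indicator {N : ℕ} {Ω : Set (RN N)} (hΩ : MeasurableSet Ω) {E : Type*}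
    [NormedAddCommGroup E] (h : Lp E 2 ((volume : Measure (RN N)).restrict Ω)) :
    ∫⁻ x, ‖Ω.indicator h x‖ₑ ^ 2 = ‖h‖ₑ ^ 2 := by
  rw [← lintegral_enorm_sq_coeFn, ← lintegral_indicator hΩ]
  refine lintegral_congr fun x => ?_
  by_cases hx : x ∈ Ω <;> simp [hx]

theorem integrable_indicator_coeFn {N : ℕ} {Ω : Set (RN N)} (hΩ : MeasurableSet Ω)
    (hfin : volume Ω < ⊤) (f : L2 Ω) : Integrable (Ω.indicator f) := by
  have : IsFiniteMeasure ((volume : Measure (RN N)).restrict Ω) := ⟨by simpa using hfin⟩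
  exact (integrable_indicator_iff hΩ).mpr ((Lp.memLp f).integrable (by norm_num))

/-- Of the margin `2 * δ`, one `δ` is spent on the segment from `x` to `x - z` and the other on the
support of the mollifier. -/
theorem closedBall_sub_smul_subset {N : ℕ} {Ω : Set (RN N)} {δ ε t : ℝ} {x z : RN N}
    (hx : x ∈ innerSet Ω (2 * δ)) (hz : ‖z‖ ≤ δ) (hε : ε ≤ δ) (ht : t ∈ Set.Icc (0 : ℝ) 1) :
    Metric.closedBall (x - t • z) ε ⊆ Ω := by
  refine (Metric.closedBall_subset_closedBall' ?_).trans (closedBall_subset_of_mem_innerSet hx)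
  have : dist (x - t • z) x ≤ ‖z‖ := by
    rw [dist_eq_norm]
    simp only [sub_sub_cancel_left, norm_neg, norm_smul, Real.norm_of_nonneg ht.1]
    exact mul_le_of_le_one_left (norm_nonneg _) ht.2
  linarith

/-- Integrate the derivative along the segment from `x` to `x - z`; it is the mollified weak
gradient tested against `z`. The time and mollifier averages are merged into one product probability
measure, so that one use of Jensen's inequality suffices. -/
theorem enorm_mollify_translate_sub_le {N : ℕ} {Ω : Set (RN N)} (hΩ : MeasurableSet Ω)
    (hfin : volume Ω < ⊤) {f : L2 Ω} {g : L2Vec Ω} (hw : IsWeakGradient Ω f g)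
    (φ : ContDiffBump (0 : RN N)) {δ : ℝ} (hφ : φ.rOut ≤ δ) {x z : RN N}
    (hx : x ∈ innerSet Ω (2 * δ)) (hz : ‖z‖ ≤ δ) :
    ‖mollify φ (Ω.indicator f) (x - z) - mollify φ (Ω.indicator f) x‖ₑ
      ≤ ∫⁻ p, ‖z‖ₑ * ‖Ω.indicator g (x - p.1 • z - p.2)‖ₑ
          ∂((volume.restrict (Set.Icc (0 : ℝ) 1)).prod (bumpMeasure φ)) := by
  have hF := (integrable_indicator_coeFn hΩ hfin f).locallyIntegrable
  have hGm := measurable_indicator_coeFn hΩ g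
  have hC := contDiff_mollify φ hF
  set u := mollify φ (Ω.indicator f) with hu
  have hcurve : ContDiff ℝ 1 fun t : ℝ => u (x - t • z) :=
    hC.comp (contDiff_const.sub (contDiff_id.smul contDiff_const))
  have h1 := enorm_sub_le_lintegral_deriv_of_contDiffOn_Icc hcurve.contDiffOn zero_le_one
  simp only [one_smul, zero_smul, sub_zero] at h1
  refine h1.trans ?_
  rw [lintegral_prod _ (by fun_prop)]
  refine setLIntegral_mono' measurableSet_Icc fun t ht => ?_
  have hd : deriv (fun t : ℝ => u (x - t • z)) t = - fderiv ℝ u (x - t • z) z := by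
    have h2 : HasDerivAt (fun t : ℝ => x - t • z) (-z) t := by
      simpa using ((hasDerivAt_id t).smul_const z).const_sub x
    have h3 := ((hC.differentiable (by simp)) (x - t • z)).hasFDerivAt.comp_hasDerivAt t h2
    simpa [Function.comp_def] using h3.deriv
  rw [hd, enorm_neg, hu, fderiv_mollify_apply hΩ φ hw hF (closedBall_sub_smul_subset hx hz hφ ht)]
  refine (enorm_integral_normed_mul_le φ (by fun_prop)).trans (lintegral_mono fun w => ?_)
  rw [← ofReal_norm, ← ofReal_norm, ← ofReal_norm, ← ENNReal.ofReal_mul (norm_nonneg _)]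
  exact ENNReal.ofReal_le_ofReal (norm_inner_le_norm _ _)

theorem lintegral_mollify_translate_sub_le {N : ℕ} {Ω : Set (RN N)} (hΩ : MeasurableSet Ω)
    (hfin : volume Ω < ⊤) {f : L2 Ω} {g : L2Vec Ω} (hw : IsWeakGradient Ω f g)
    (φ : ContDiffBump (0 : RN N)) {δ : ℝ} (hφ : φ.rOut ≤ δ) {z : RN N} (hz : ‖z‖ ≤ δ) :
    ∫⁻ x in innerSet Ω (2 * δ),
        ‖mollify φ (Ω.indicator f) (x - z) - mollify φ (Ω.indicator f) x‖ₑ ^ 2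
      ≤ (‖z‖ₑ * ‖g‖ₑ) ^ 2 := by
  have hGm := measurable_indicator_coeFn hΩ g
  have : IsProbabilityMeasure ((volume : Measure ℝ).restrict (Set.Icc (0 : ℝ) 1)) :=
    ⟨by simp⟩
  refine (setLIntegral_mono' (isOpen_innerSet _ _).measurableSet fun x hx => pow_le_pow_left'
    (enorm_mollify_translate_sub_le hΩ hfin hw φ hφ hx hz) 2).trans ?_
  -- For each fixed `p` the integrand is a translate of `g` extended by zero, so translation
  -- invariance bounds its mean square uniformly in `p`.
  refine lintegral_sq_lintegral_le (by fun_prop) (Filter.Eventually.of_forall fun p => ?_)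
  refine (setLIntegral_le_lintegral _ _).trans (le_of_eq ?_)
  simp only [mul_pow]
  rw [lintegral_const_mul _ (by fun_prop), ← lintegral_enorm_sq_indicator hΩ g]
  simp only [sub_sub]
  rw [lintegral_sub_right_eq_self (fun x => ‖Ω.indicator g x‖ₑ ^ 2)]

/-- The `L²` modulus of continuity of a function with a weak gradient in `L²`. -/
theorem lintegral_translate_sub_le {N : ℕ} {Ω : Set (RN N)} (hΩ : MeasurableSet Ω)
    (hfin : volume Ω < ⊤) {f : L2 Ω} {g : L2Vec Ω} (hw : IsWeakGradient Ω f g)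
    {δ : ℝ} (hδ : 0 < δ) {z : RN N} (hz : ‖z‖ ≤ δ) :
    ∫⁻ x in innerSet Ω (2 * δ), ‖Ω.indicator f (x - z) - Ω.indicator f x‖ₑ ^ 2
      ≤ (‖z‖ₑ * ‖g‖ₑ) ^ 2 := by
  have hF := (integrable_indicator_coeFn hΩ hfin f).locallyIntegrable
  have hpos : ∀ n : ℕ, 0 < δ / ((n : ℝ) + 1) := fun n => by positivity
  -- The bumps shrink to a point with radii at most `δ`: the bound for mollified functions is
  -- uniform in `n` and passes to the limit by Fatou's lemma.
  set φ : ℕ → ContDiffBump (0 : RN N) := fun n => radialBump N (hpos n) with hφ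
  have hle : ∀ n, (φ n).rOut ≤ δ := fun n =>
    div_le_self hδ.le (by linarith [n.cast_nonneg (α := ℝ)])
  have hlim : Filter.Tendsto (fun n => (φ n).rOut) Filter.atTop (nhds 0) := by
    have := (tendsto_one_div_add_atTop_nhds_zero_nat (𝕜 := ℝ)).const_mul δ
    simpa [hφ, radialBump, div_eq_mul_inv] using this
  -- `K = 2` is the ratio of outer to inner radius of `radialBump`; a bounded ratio gives almost
  -- everywhere convergence.
  have hae : ∀ᵐ x, Filter.Tendsto (fun n => mollify (φ n) (Ω.indicator f) x) Filter.atTop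
      (nhds (Ω.indicator f x)) :=
    ContDiffBump.ae_convolution_tendsto_right_of_locallyIntegrable (K := 2) hlim
      (Filter.Eventually.of_forall fun n => by simp [hφ, radialBump]; linarith) hF
  have hae' : ∀ᵐ x, Filter.Tendsto (fun n => mollify (φ n) (Ω.indicator f) (x - z)) Filter.atTop
      (nhds (Ω.indicator f (x - z))) :=
    (measurePreserving_sub_right volume z).quasiMeasurePreserving.ae hae
  calc ∫⁻ x in innerSet Ω (2 * δ), ‖Ω.indicator f (x - z) - Ω.indicator f x‖ₑ ^ 2
      = ∫⁻ x in innerSet Ω (2 * δ), Filter.liminf (fun n =>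
          ‖mollify (φ n) (Ω.indicator f) (x - z) - mollify (φ n) (Ω.indicator f) x‖ₑ ^ 2)
          Filter.atTop := by
        refine lintegral_congr_ae (ae_restrict_of_ae ?_)
        filter_upwards [hae, hae'] with x h1 h2
        exact (((ENNReal.continuous_pow 2).tendsto _).comp (h2.sub h1).enorm).liminf_eq.symm
    _ ≤ Filter.liminf (fun n => ∫⁻ x in innerSet Ω (2 * δ),
          ‖mollify (φ n) (Ω.indicator f) (x - z) - mollify (φ n) (Ω.indicator f) x‖ₑ ^ 2)
          Filter.atTop := by
        refine lintegral_liminf_le fun n => ?_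
        have := (contDiff_mollify (φ n) hF).continuous.measurable
        fun_prop
    _ ≤ (‖z‖ₑ * ‖g‖ₑ) ^ 2 := by
        refine Filter.liminf_le_of_le (by isBoundedDefault) fun b hb => ?_
        obtain ⟨n, hn⟩ := hb.exists
        exact hn.trans (lintegral_mollify_translate_sub_le hΩ hfin hw (φ n) (hle n) hz)

/-- Mollification at scale `δ` changes a function by at most `δ ‖∇f‖` in `L²`. -/
theorem lintegral_mollify_sub_le {N : ℕ} {Ω : Set (RN N)} (hΩ : MeasurableSet Ω)
    (hfin : volume Ω < ⊤) {f : L2 Ω} {g : L2Vec Ω} (hw : IsWeakGradient Ω f g)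
    {δ : ℝ} (hδ : 0 < δ) :
    ∫⁻ x in innerSet Ω (2 * δ), ‖mollify (radialBump N hδ) (Ω.indicator f) x - Ω.indicator f x‖ₑ ^ 2
      ≤ (ENNReal.ofReal δ * ‖g‖ₑ) ^ 2 := by
  have hF := (integrable_indicator_coeFn hΩ hfin f).locallyIntegrable
  have hFm := measurable_indicator_coeFn hΩ f
  set φ := radialBump N hδ with hφ
  have hpt : ∀ x, ‖mollify φ (Ω.indicator f) x - Ω.indicator f x‖ₑ
      ≤ ∫⁻ w, ‖Ω.indicator f (x - w) - Ω.indicator f x‖ₑ ∂bumpMeasure φ := by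
    intro x
    have hex : Integrable fun w => φ.normed volume w * Ω.indicator f (x - w) :=
      φ.hasCompactSupport_normed.convolutionExists_left (ContinuousLinearMap.lsmul ℝ ℝ)
        φ.continuous_normed hF x
    -- The bump has integral one, so `f x` can be moved under the integral.
    have : mollify φ (Ω.indicator f) x - Ω.indicator f x
        = ∫ w, φ.normed volume w * (Ω.indicator f (x - w) - Ω.indicator f x) := by
      simp only [mul_sub]
      rw [integral_sub hex (φ.integrable_normed.mul_const _), integral_mul_const,
        φ.integral_normed, one_mul, mollify_apply]
    rw [this]
    exact enorm_integral_normed_mul_le φ (by fun_prop)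
  refine (lintegral_mono fun x => pow_le_pow_left' (hpt x) 2).trans ?_
  refine lintegral_sq_lintegral_le (by fun_prop) ?_
  filter_upwards [ae_bumpMeasure_norm_le φ] with w hw'
  refine (lintegral_translate_sub_le hΩ hfin hw hδ hw').trans ?_
  gcongr
  rw [← ofReal_norm]
  exact ENNReal.ofReal_le_ofReal hw'

/-! ### The truncated mollification operator -/

/-- The translates of a normalized bump function, as elements of `L²(Ω)`. -/
noncomputable def bumpTranslate {N : ℕ} (Ω : Set (RN N)) (φ : ContDiffBump (0 : RN N))
    (x : RN N) : L2 Ω :=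
  MemLp.toLp (fun y => φ.normed volume (x - y)) (IsTestFun.memLp (Ω := Set.univ)
    (isTestFun_normed_sub φ (Set.subset_univ _)) |>.mono_measure (by
      simpa using Measure.restrict_le_self))

theorem coeFn_bumpTranslate {N : ℕ} (Ω : Set (RN N)) (φ : ContDiffBump (0 : RN N)) (x : RN N) :
    bumpTranslate Ω φ x =ᵐ[volume.restrict Ω] fun y => φ.normed volume (x - y) :=
  MemLp.coeFn_toLp _

theorem inner_bumpTranslate {N : ℕ} {Ω : Set (RN N)} (hΩ : MeasurableSet Ω)
    (φ : ContDiffBump (0 : RN N)) (x : RN N) (f : L2 Ω) :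
    inner ℝ (bumpTranslate Ω φ x) f = mollify φ (Ω.indicator f) x := by
  rw [L2.inner_def, mollify_apply_swap]
  calc _ = ∫ y in Ω, φ.normed volume (x - y) * f y := by
        refine integral_congr_ae ?_
        filter_upwards [coeFn_bumpTranslate Ω φ x] with y hy
        simp [hy, mul_comm]
    _ = _ := by
        rw [← integral_indicator hΩ]
        refine integral_congr_ae (Filter.Eventually.of_forall fun y => ?_)
        by_cases hy : y ∈ Ω <;> simp [hy]

theorem norm_bumpTranslate_le {N : ℕ} (Ω : Set (RN N)) (φ : ContDiffBump (0 : RN N)) (x : RN N) :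
    ‖bumpTranslate Ω φ x‖ ≤ (eLpNorm (φ.normed volume) 2 volume).toReal := by
  have hm : MemLp (φ.normed volume) 2 volume :=
    φ.continuous_normed.memLp_of_hasCompactSupport φ.hasCompactSupport_normed
  have hle : eLpNorm (fun y => φ.normed volume (x - y)) 2 ((volume : Measure (RN N)).restrict Ω)
      ≤ eLpNorm (φ.normed volume) 2 volume :=
    (eLpNorm_mono_measure _ Measure.restrict_le_self).trans
      (eLpNorm_comp_measurePreserving (g := φ.normed volume) (f := fun y => x - y) hm.1
        (Measure.measurePreserving_sub_left volume x)).le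
  rw [Lp.norm_def, eLpNorm_congr_ae (coeFn_bumpTranslate Ω φ x)]
  exact ENNReal.toReal_mono hm.2.ne hle

/-- Supplies the measurability of the kernel. The bump is uniformly continuous, and uniform
closeness gives `L²` closeness on a set of finite measure. -/
theorem continuous_bumpTranslate {N : ℕ} {Ω : Set (RN N)} (hfin : volume Ω < ⊤)
    (φ : ContDiffBump (0 : RN N)) : Continuous (bumpTranslate Ω φ) := by
  have : IsFiniteMeasure ((volume : Measure (RN N)).restrict Ω) := ⟨by simpa using hfin⟩
  have huc : UniformContinuous (φ.normed volume) :=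
    φ.continuous_normed.uniformContinuous_of_tendsto_cocompact (x := 0)
      (φ.hasCompactSupport_normed (μ := volume)).is_zero_at_infty
  set c : ℝ := (((volume : Measure (RN N)).restrict Ω) Set.univ).toReal ^ (1 / (2 : ℝ)) with hc
  have hc0 : 0 ≤ c := by positivity
  rw [Metric.continuous_iff]
  intro x ε hε
  obtain ⟨η, hη, H⟩ := Metric.uniformContinuous_iff.mp huc (ε / (c + 1)) (by positivity)
  refine ⟨η, hη, fun y hy => ?_⟩
  have hb : ∀ᵐ w ∂((volume : Measure (RN N)).restrict Ω),
      ‖(bumpTranslate Ω φ y - bumpTranslate Ω φ x : L2 Ω) w‖ ≤ ε / (c + 1) := by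
    filter_upwards [coeFn_bumpTranslate Ω φ x, coeFn_bumpTranslate Ω φ y,
      Lp.coeFn_sub (bumpTranslate Ω φ y) (bumpTranslate Ω φ x)] with w h1 h2 h3
    rw [h3, Pi.sub_apply, h1, h2, ← dist_eq_norm]
    exact (H (by simpa using hy)).le
  have := Lp.norm_le_of_ae_bound (by positivity) hb
  rw [dist_eq_norm]
  refine this.trans_lt ?_
  have h4 : ((measureUnivNNReal ((volume : Measure (RN N)).restrict Ω) : ℝ)
      ^ (ENNReal.toReal 2)⁻¹) = c := by
    simp [hc, measureUnivNNReal, ENNReal.coe_toNNReal_eq_toReal]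
  have h5 : c * (ε / (c + 1)) < ε := by
    rw [mul_div_assoc', div_lt_iff₀ (by positivity)]; nlinarith
  rw [h4]
  exact h5

/-- A bounded measurable field is square integrable when `|Ω| < ∞`; this makes truncated
mollification compact. -/
theorem memLp_bumpKernel {N : ℕ} {Ω S : Set (RN N)} (hfin : volume Ω < ⊤) (hS : MeasurableSet S)
    (φ : ContDiffBump (0 : RN N)) :
    MemLp (S.indicator (bumpTranslate Ω φ)) 2 ((volume : Measure (RN N)).restrict Ω) := by
  have : IsFiniteMeasure ((volume : Measure (RN N)).restrict Ω) := ⟨by simpa using hfin⟩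
  exact MemLp.indicator hS (MemLp.of_bound
    (continuous_bumpTranslate hfin φ).aestronglyMeasurable _
    (Filter.Eventually.of_forall (norm_bumpTranslate_le Ω φ)))

/-- The operator `f ↦ 1_S (φ ⋆ f)` on `L²(Ω)`. -/
noncomputable def mollifyOperator {N : ℕ} {Ω S : Set (RN N)} (hfin : volume Ω < ⊤)
    (hS : MeasurableSet S) (φ : ContDiffBump (0 : RN N)) : L2 Ω →L[ℝ] L2 Ω :=
  kernelOperator _ _ (memLp_bumpKernel hfin hS φ).toLp

theorem coeFn_mollifyOperator {N : ℕ} {Ω S : Set (RN N)} (hΩ : MeasurableSet Ω)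
    (hfin : volume Ω < ⊤) (hS : MeasurableSet S) (φ : ContDiffBump (0 : RN N)) (f : L2 Ω) :
    mollifyOperator hfin hS φ f =ᵐ[volume.restrict Ω]
      S.indicator (mollify φ (Ω.indicator f)) := by
  filter_upwards [coeFn_kernelOperator (memLp_bumpKernel hfin hS φ).toLp f,
    (memLp_bumpKernel hfin hS φ).coeFn_toLp] with x h1 h2
  rw [mollifyOperator, h1, h2]
  by_cases hx : x ∈ S
  · rw [Set.indicator_of_mem hx, Set.indicator_of_mem hx, real_inner_comm,
      inner_bumpTranslate hΩ]
  · simp [hx]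

/-! ### Compactness of the embedding -/

theorem H1.isWeakGradient {N : ℕ} {Ω : Set (RN N)} (f : H1 Ω) :
    IsWeakGradient Ω (H1.toL2 Ω f) (H1.grad Ω f) := f.2

/-- Hölder's inequality on `A`; since `q > 2` the exponent is positive, so the bound is small on
sets of small measure. -/
theorem eLpNorm_two_restrict_le {N : ℕ} {Ω A : Set (RN N)} {q : ℝ} (hq : 2 < q) (f : L2 Ω) :
    eLpNorm f 2 (((volume : Measure (RN N)).restrict Ω).restrict A)
      ≤ normOn Ω q f * (volume.restrict Ω) A ^ (1 / 2 - 1 / q) := by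
  have h := eLpNorm_le_eLpNorm_mul_rpow_measure_univ (p := 2) (q := ENNReal.ofReal q)
    (μ := ((volume : Measure (RN N)).restrict Ω).restrict A)
    (by rw [← ENNReal.ofReal_ofNat 2]; exact ENNReal.ofReal_le_ofReal hq.le)
    ((Lp.aestronglyMeasurable f).restrict)
  rw [Measure.restrict_apply_univ, ENNReal.toReal_ofReal (by linarith), ENNReal.toReal_ofNat] at h
  refine h.trans ?_
  gcongr
  exact eLpNorm_mono_measure _ Measure.restrict_le_self

/-- The error splits into `u` itself on the boundary layer, controlled by the `L^q` bound, and `u -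
φ ⋆ u` on the inner set, controlled by `δ ‖∇u‖₂`. -/
theorem norm_toL2_sub_mollifyOperator_le {N : ℕ} {Ω : Set (RN N)} (hΩ : IsOpen Ω)
    (hfin : volume Ω < ⊤) {q C : ℝ} (hq : 2 < q)
    (hC : ∀ f : H1 Ω, normOn Ω q (H1.toL2 Ω f) ≤ ENNReal.ofReal (C * ‖f‖)) (hC0 : 0 ≤ C)
    {δ : ℝ} (hδ : 0 < δ) (f : H1 Ω) :
    ‖H1.toL2 Ω f - mollifyOperator hfin (isOpen_innerSet Ω (2 * δ)).measurableSet (radialBump N hδ)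
        (H1.toL2 Ω f)‖
      ≤ (C * ((volume.restrict Ω) (Metric.cthickening (2 * δ) Ωᶜ)).toReal ^ (1 / 2 - 1 / q) + δ)
        * ‖f‖ := by
  have : IsFiniteMeasure ((volume : Measure (RN N)).restrict Ω) := ⟨by simpa using hfin⟩
  set S := innerSet Ω (2 * δ) with hSdef
  have hS : MeasurableSet S := (isOpen_innerSet Ω (2 * δ)).measurableSet
  have hSc : Sᶜ = Metric.cthickening (2 * δ) Ωᶜ := compl_compl _
  set μ := (volume : Measure (RN N)).restrict Ω with hμ
  set u := H1.toL2 Ω f with hu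
  set F := Ω.indicator (u : RN N → ℝ) with hF
  set v := mollify (radialBump N hδ) F with hv
  have hFm : Measurable F := measurable_indicator_coeFn hΩ.measurableSet u
  have hvm : Measurable v := (contDiff_mollify _ (integrable_indicator_coeFn hΩ.measurableSet
    hfin u).locallyIntegrable).continuous.measurable
  have hae : (u - mollifyOperator hfin hS (radialBump N hδ) u : L2 Ω) =ᵐ[μ]
      (Sᶜ.indicator u + S.indicator (fun x => F x - v x)) := by
    filter_upwards [Lp.coeFn_sub u (mollifyOperator hfin hS (radialBump N hδ) u),
      coeFn_mollifyOperator hΩ.measurableSet hfin hS (radialBump N hδ) u,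
      ae_restrict_mem hΩ.measurableSet] with x h1 h2 h3
    rw [h1, Pi.sub_apply, h2]
    by_cases hx : x ∈ S <;> simp [hx, hF, h3, hv]
  have hA : eLpNorm (Sᶜ.indicator u) 2 μ
      ≤ ENNReal.ofReal (C * ‖f‖ * (μ Sᶜ).toReal ^ (1 / 2 - 1 / q)) := by
    rw [eLpNorm_indicator_eq_eLpNorm_restrict hS.compl]
    refine (eLpNorm_two_restrict_le hq u).trans ?_
    have he : 0 ≤ 1 / 2 - 1 / q := by
      rw [sub_nonneg]; exact one_div_le_one_div_of_le (by norm_num) hq.le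
    rw [ENNReal.ofReal_mul (by positivity), ← ENNReal.ofReal_rpow_of_nonneg ENNReal.toReal_nonneg he,
      ENNReal.ofReal_toReal (measure_ne_top _ _)]
    gcongr
    exact hC f
  have hB : eLpNorm (S.indicator (fun x => F x - v x)) 2 μ ≤ ENNReal.ofReal (δ * ‖f‖) := by
    rw [eLpNorm_indicator_eq_eLpNorm_restrict hS, hμ, Measure.restrict_restrict hS,
      Set.inter_eq_left.mpr (innerSet_subset Ω _)]
    have h1 := lintegral_mollify_sub_le hΩ.measurableSet hfin (H1.isWeakGradient f) hδ
    have h2 := eLpNorm_nnreal_pow_eq_lintegral (f := fun x => F x - v x)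
      (μ := volume.restrict S) (p := 2) (by norm_num)
    norm_num at h2
    have h3 : eLpNorm (fun x => F x - v x) 2 (volume.restrict S) ^ 2
        ≤ (ENNReal.ofReal δ * ‖H1.grad Ω f‖ₑ) ^ 2 := by
      rw [h2]
      refine le_trans (le_of_eq (lintegral_congr fun x => ?_)) h1
      rw [← enorm_neg, neg_sub]
    refine ((ENNReal.pow_le_pow_left_iff (by norm_num)).mp h3).trans ?_
    rw [ENNReal.ofReal_mul hδ.le, ← ofReal_norm]
    gcongr
    exact H1.norm_grad_le f
  have hsum := (eLpNorm_add_le (((Lp.memLp u).1.indicator hS.compl))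
    ((hFm.sub hvm).indicator hS).aestronglyMeasurable (by norm_num : (1 : ℝ≥0∞) ≤ 2)).trans
      (add_le_add hA hB)
  rw [Lp.norm_def, eLpNorm_congr_ae hae]
  rw [← ENNReal.ofReal_add (by positivity) (by positivity)] at hsum
  refine (ENNReal.toReal_le_of_le_ofReal (by positivity) hsum).trans (le_of_eq ?_)
  rw [hSc]
  ring

theorem isCompactOperator_of_norm_sub_le {E F : Type*} [NormedAddCommGroup E] [NormedSpace ℝ E]
    [NormedAddCommGroup F] [NormedSpace ℝ F] [CompleteSpace F] {T : E →L[ℝ] F}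
    {S : ℕ → E →L[ℝ] F} {c : ℕ → ℝ} (hc : Filter.Tendsto c Filter.atTop (nhds 0))
    (hc0 : ∀ n, 0 ≤ c n) (hTS : ∀ n v, ‖T v - S n v‖ ≤ c n * ‖v‖)
    (hS : ∀ n, IsCompactOperator (S n)) : IsCompactOperator T := by
  have h : Filter.Tendsto S Filter.atTop (nhds T) := by
    rw [tendsto_iff_norm_sub_tendsto_zero]
    refine squeeze_zero (fun _ => norm_nonneg _) (fun n => ?_) hc
    rw [norm_sub_rev]
    exact ContinuousLinearMap.opNorm_le_bound _ (hc0 n) (hTS n)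
  exact isCompactOperator_of_tendsto h (Filter.Eventually.of_forall hS)

/-- If `H¹(Ω)` embeds into `L^q(Ω)` with `q > 2`, its embedding into `L²(Ω)` is compact. -/
theorem isCompactOperator_toL2 {N : ℕ} {Ω : Set (RN N)} (hΩ : IsOpen Ω)
    (hfin : volume Ω < ⊤) {q C : ℝ} (hq : 2 < q) (hC0 : 0 ≤ C)
    (hC : ∀ f : H1 Ω, normOn Ω q (H1.toL2 Ω f) ≤ ENNReal.ofReal (C * ‖f‖)) :
    IsCompactOperator (H1.toL2 Ω) := by
  have : IsFiniteMeasure ((volume : Measure (RN N)).restrict Ω) := ⟨by simpa using hfin⟩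
  have hpos : ∀ n : ℕ, 0 < 1 / ((n : ℝ) + 1) := fun n => by positivity
  set T : ℕ → H1 Ω →L[ℝ] L2 Ω := fun n =>
    (mollifyOperator hfin (isOpen_innerSet Ω (2 * (1 / ((n : ℝ) + 1)))).measurableSet
      (radialBump N (hpos n))).comp (H1.toL2 Ω) with hT
  have he : 0 < 1 / 2 - 1 / q := by
    rw [sub_pos]; exact one_div_lt_one_div_of_lt (by norm_num) hq
  have hlim1 := tendsto_one_div_add_atTop_nhds_zero_nat (𝕜 := ℝ)
  have hlim : Filter.Tendsto (fun δ : ℝ => C * ((volume.restrict Ω)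
      (Metric.cthickening (2 * δ) Ωᶜ)).toReal ^ (1 / 2 - 1 / q) + δ) (nhds 0) (nhds 0) := by
    -- The complement of `Ω` is closed, so its thickenings shrink to it, and it is null for the
    -- finite measure restricted to `Ω`.
    have h1 := tendsto_measure_cthickening_of_isClosed (μ := (volume : Measure (RN N)).restrict Ω)
      ⟨1, one_pos, measure_ne_top _ _⟩ hΩ.isClosed_compl
    rw [Measure.restrict_apply hΩ.measurableSet.compl, Set.compl_inter_self, measure_empty] at h1
    have h2 : Filter.Tendsto (fun δ : ℝ => 2 * δ) (nhds 0) (nhds 0) := by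
      simpa using (continuous_const_mul (2 : ℝ)).tendsto 0
    have h3 := (ENNReal.tendsto_toReal ENNReal.zero_ne_top).comp (h1.comp h2)
    have h4 := (h3.rpow_const (Or.inr he.le)).const_mul C |>.add Filter.tendsto_id
    simp only [ENNReal.toReal_zero, Real.zero_rpow he.ne', mul_zero, add_zero] at h4
    exact h4
  refine isCompactOperator_of_norm_sub_le (S := T) (hlim.comp hlim1)
    (fun n => by simp only [Function.comp_apply]; positivity)
    (fun n f => norm_toL2_sub_mollifyOperator_le hΩ hfin hq hC hC0 (hpos n) f) fun n => ?_
  have h := isCompactOperator_kernelOperator (memLp_bumpKernel hfin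
    (isOpen_innerSet Ω (2 * (1 / ((n : ℝ) + 1)))).measurableSet (radialBump N (hpos n))).toLp
  exact h.comp_clm (H1.toL2 Ω)

/-! ### Functions with zero weak gradient -/

theorem ball_subset_innerSet {N : ℕ} {Ω : Set (RN N)} {x : RN N} {r : ℝ} (hr : 0 < r)
    (h : Metric.ball x (3 * r) ⊆ Ω) : Metric.ball x r ⊆ innerSet Ω r := by
  intro y hy hy'
  obtain ⟨w, hw, hyw⟩ := Metric.mem_thickening_iff.mp
    (Metric.cthickening_subset_thickening' (δ₂ := 2 * r) (by positivity) (by linarith) _ hy')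
  refine hw (h ?_)
  have := dist_triangle w y x
  rw [Metric.mem_ball] at hy ⊢
  rw [dist_comm] at hyw
  linarith

theorem fderiv_mollify_eq_zero {N : ℕ} {Ω : Set (RN N)} (hΩ : MeasurableSet Ω)
    (hfin : volume Ω < ⊤) (φ : ContDiffBump (0 : RN N)) {f : L2 Ω}
    (hw : IsWeakGradient Ω f (0 : L2Vec Ω)) {x : RN N}
    (hx : Metric.closedBall x φ.rOut ⊆ Ω) :
    fderiv ℝ (mollify φ (Ω.indicator f)) x = 0 := by
  ext z
  rw [fderiv_mollify_apply hΩ φ hw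
    (integrable_indicator_coeFn hΩ hfin f).locallyIntegrable hx]
  have h0 : ∀ᵐ y, Ω.indicator (0 : L2Vec Ω) y = 0 := by
    filter_upwards [(ae_restrict_iff' hΩ).mp
      (Lp.coeFn_zero (RN N) 2 ((volume : Measure (RN N)).restrict Ω))] with y hy
    by_cases hyΩ : y ∈ Ω
    · rw [Set.indicator_of_mem hyΩ, hy hyΩ, Pi.zero_apply]
    · exact Set.indicator_of_notMem hyΩ _
  have h1 : ∀ᵐ w, Ω.indicator (0 : L2Vec Ω) (x - w) = 0 :=
    (quasiMeasurePreserving_sub_left volume x).ae h0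
  refine (integral_eq_zero_of_ae ?_).trans (by simp)
  filter_upwards [h1] with w hw
  rw [hw]
  simp

/-- Near `x` the mollified function has zero derivative, hence is constant. With zero gradient the
mollification estimate says that `f` equals its mollification almost everywhere, already at one
fixed scale. The filter `nhds y ⊓ ae volume` expresses equality almost everywhere near `y`. -/
theorem exists_eventually_eq_const {N : ℕ} {Ω : Set (RN N)} (hΩ : IsOpen Ω)
    (hfin : volume Ω < ⊤) {f : L2 Ω} (hw : IsWeakGradient Ω f (0 : L2Vec Ω)) {x : RN N}
    (hx : x ∈ Ω) :
    ∃ c : ℝ, ∀ᶠ y in nhds x, ∀ᶠ w in nhds y ⊓ ae volume, Ω.indicator f w = c := by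
  obtain ⟨ε, hε, hball⟩ := Metric.isOpen_iff.mp hΩ x hx
  -- The mollification estimate lives on `innerSet Ω (2 * (ε / 6))`, and three times this radius is
  -- `ε`, as `ball_subset_innerSet` requires.
  have hδ : 0 < ε / 6 := by positivity
  set v := mollify (radialBump N hδ) (Ω.indicator f) with hv
  set U := Metric.ball x (2 * (ε / 6)) with hU
  have hUS : U ⊆ innerSet Ω (2 * (ε / 6)) :=
    ball_subset_innerSet (by positivity) (by convert hball using 2; ring)
  have hC : ContDiff ℝ 1 v := contDiff_mollify _
    (integrable_indicator_coeFn hΩ.measurableSet hfin f).locallyIntegrable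
  have hconst : ∀ y ∈ U, v y = v x := fun y hy => by
    refine Metric.isOpen_ball.is_const_of_fderiv_eq_zero (convex_ball x _).isPreconnected
      (hC.differentiable (by simp)).differentiableOn (fun y hy => ?_) hy
      (Metric.mem_ball_self (by positivity))
    refine fderiv_mollify_eq_zero hΩ.measurableSet hfin _ hw ?_
    exact (Metric.closedBall_subset_closedBall (by simp [radialBump]; linarith)).trans
      (closedBall_subset_of_mem_innerSet (hUS hy))
  have hzero := lintegral_mollify_sub_le hΩ.measurableSet hfin hw hδ
  simp only [enorm_zero, mul_zero, ne_eq, OfNat.ofNat_ne_zero, not_false_eq_true, zero_pow,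
    nonpos_iff_eq_zero] at hzero
  have hFm : Measurable (Ω.indicator f) := measurable_indicator_coeFn hΩ.measurableSet f
  have hvm := hC.continuous.measurable
  rw [← hv, lintegral_eq_zero_iff (by fun_prop)] at hzero
  have hae := (ae_restrict_iff' (isOpen_innerSet Ω (2 * (ε / 6))).measurableSet).mp hzero
  refine ⟨v x, ?_⟩
  filter_upwards [Metric.isOpen_ball.mem_nhds
    (Metric.mem_ball_self (x := x) (ε := 2 * (ε / 6)) (by positivity))] with y hy
  filter_upwards [Filter.mem_inf_of_left (Metric.isOpen_ball.mem_nhds hy),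
    Filter.mem_inf_of_right hae] with w hwU hw'
  have h1 := hw' (hUS hwU)
  simp only [Pi.zero_apply, ne_eq, OfNat.ofNat_ne_zero, not_false_eq_true, pow_eq_zero_iff,
    enorm_eq_zero] at h1
  rw [← hconst w hwU]
  exact (sub_eq_zero.mp h1).symm

/-- Neighbourhoods are not null, so two local almost-everywhere constants at the same point must
agree. -/
theorem neBot_nhds_inf_ae {X : Type*} [TopologicalSpace X] [MeasurableSpace X] (μ : Measure X)
    [μ.IsOpenPosMeasure] (x : X) : (nhds x ⊓ ae μ).NeBot := by
  rw [Filter.inf_neBot_iff]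
  intro U hU V hV
  by_contra h
  have hsub : U ⊆ Vᶜ := fun y hy hyV => h ⟨y, hy, hyV⟩
  exact (Measure.measure_pos_of_mem_nhds μ hU).ne' (measure_mono_null hsub (mem_ae_iff.mp hV))

/-- A function with vanishing weak gradient on a domain is constant. -/
theorem exists_ae_eq_const_of_isWeakGradient_zero {N : ℕ} {Ω : Set (RN N)} (hΩ : IsDomainOfRN Ω)
    (hfin : volume Ω < ⊤) {f : L2 Ω} (hw : IsWeakGradient Ω f (0 : L2Vec Ω)) :
    ∃ c : ℝ, ∀ᵐ x ∂volume.restrict Ω, f x = c := by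
  obtain ⟨x₀, hx₀⟩ := hΩ.2.nonempty
  obtain ⟨c, hc⟩ := exists_eventually_eq_const hΩ.1 hfin hw hx₀
  have key : ∀ x ∈ Ω, ∃ c : ℝ, (∀ᶠ w in nhds x₀ ⊓ ae volume, Ω.indicator f w = c)
      ∧ ∀ᶠ w in nhds x ⊓ ae volume, Ω.indicator f w = c := by
    intro x hx
    -- Sharing a local constant is a symmetric, transitive relation that holds between nearby
    -- points, so on a connected set it relates all points.
    refine hΩ.2.isPreconnected.induction₂ (fun x y => ∃ c : ℝ,
      (∀ᶠ w in nhds x ⊓ ae volume, Ω.indicator f w = c)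
      ∧ ∀ᶠ w in nhds y ⊓ ae volume, Ω.indicator f w = c) ?_ ?_ ?_ hx₀ hx
    · intro x hx
      obtain ⟨c, hc⟩ := exists_eventually_eq_const hΩ.1 hfin hw hx
      filter_upwards [mem_nhdsWithin_of_mem_nhds hc] with y hy
      exact ⟨c, hc.self_of_nhds, hy⟩
    · rintro x y z - - - ⟨c, hx, hy⟩ ⟨d, hy', hz⟩
      have := neBot_nhds_inf_ae (volume : Measure (RN N)) y
      obtain ⟨w, h1, h2⟩ := (hy.and hy').exists
      exact ⟨c, hx, by rwa [← h1, h2]⟩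
    · rintro x y - - ⟨c, hx, hy⟩
      exact ⟨c, hy, hx⟩
  refine ⟨c, (ae_restrict_iff' hΩ.1.measurableSet).mpr ?_⟩
  rw [ae_iff]
  refine measure_null_of_locally_null _ fun x hx => ?_
  simp only [Classical.not_imp, Set.mem_ofPred_eq] at hx
  obtain ⟨d, h0, hd⟩ := key x hx.1
  have := neBot_nhds_inf_ae (volume : Measure (RN N)) x₀
  obtain ⟨w, h1, h2⟩ := (h0.and hc.self_of_nhds).exists
  obtain rfl : d = c := h1.symm.trans h2
  obtain ⟨U, hU, V, hV, hUV⟩ := Filter.mem_inf_iff_superset.mp hd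
  refine ⟨_, Filter.inter_mem self_mem_nhdsWithin (mem_nhdsWithin_of_mem_nhds hU), ?_⟩
  refine measure_mono_null (t := Vᶜ) (fun y hy hyV => ?_) (mem_ae_iff.mp hV)
  obtain ⟨hy1, hyU⟩ := hy
  simp only [Classical.not_imp, Set.mem_ofPred_eq] at hy1
  have h3 : Ω.indicator f y = d := hUV ⟨hyU, hyV⟩
  rw [Set.indicator_of_mem hy1.1] at h3
  exact hy1.2 h3

/-! ### The Poincaré inequality -/

theorem tendsto_integral_mul {N : ℕ} {Ω : Set (RN N)} {w : ℕ → L2 Ω} {u : L2 Ω}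
    (h : Filter.Tendsto w Filter.atTop (nhds u)) {ξ : RN N → ℝ}
    (hξ : MemLp ξ 2 ((volume : Measure (RN N)).restrict Ω)) :
    Filter.Tendsto (fun n => ∫ x in Ω, w n x * ξ x) Filter.atTop
      (nhds (∫ x in Ω, u x * ξ x)) := by
  have heq : ∀ v : L2 Ω, ∫ x in Ω, v x * ξ x = inner ℝ hξ.toLp v := by
    intro v
    rw [L2.inner_def]
    refine integral_congr_ae ?_
    filter_upwards [hξ.coeFn_toLp] with x hx
    simp [hx]
  simp only [heq]
  exact tendsto_const_nhds.inner h

/-- The weak gradient is a closed operator: for a fixed test function, both sides of the defining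
identity are `L²` pairings, continuous in `f` and in `g`. -/
theorem isWeakGradient_of_tendsto {N : ℕ} {Ω : Set (RN N)} {w : ℕ → L2 Ω} {u : L2 Ω}
    {g : ℕ → L2Vec Ω} {g' : L2Vec Ω} (hw : Filter.Tendsto w Filter.atTop (nhds u))
    (hg : Filter.Tendsto g Filter.atTop (nhds g')) (h : ∀ n, IsWeakGradient Ω (w n) (g n)) :
    IsWeakGradient Ω u g' := by
  intro φ hφ i
  have h1 := tendsto_integral_mul hw (hφ.memLp_partialDeriv i)
  set P := (EuclideanSpace.proj (𝕜 := ℝ) i : RN N →L[ℝ] ℝ).compLpL 2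
    ((volume : Measure (RN N)).restrict Ω) with hP
  have h2 := tendsto_integral_mul ((P.continuous.tendsto _).comp hg) hφ.memLp
  have heq : ∀ v : L2Vec Ω, ∫ x in Ω, P v x * φ x = ∫ x in Ω, v x i * φ x := by
    intro v
    refine integral_congr_ae ?_
    filter_upwards [ContinuousLinearMap.coeFn_compLpL
      (EuclideanSpace.proj (𝕜 := ℝ) i : RN N →L[ℝ] ℝ) v] with x hx
    rw [hx]
    simp
  simp only [Function.comp_apply, heq] at h2
  refine tendsto_nhds_unique h1 (h2.neg.congr fun n => ?_)
  exact (h n φ hφ i).symm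

/-- Integration by parts against the constant `1`; it puts constants in `H¹` with zero gradient. -/
theorem integral_partialDeriv_eq_zero {N : ℕ} {Ω : Set (RN N)}
    {φ : RN N → ℝ} (hφ : IsTestFun Ω φ) (i : Fin N) : ∫ x in Ω, partialDeriv i φ x = 0 := by
  have hc : Continuous (partialDeriv i φ) :=
    (hφ.1.continuous_fderiv (by simp)).clm_apply continuous_const
  have hs : HasCompactSupport (partialDeriv i φ) := hφ.2.1.fderiv_apply ℝ _
  rw [setIntegral_eq_integral_of_forall_compl_eq_zero fun x hx => ?_]
  · have := integral_mul_fderiv_eq_neg_fderiv_mul_of_integrable (𝕜 := ℝ) (f := fun _ => (1 : ℝ))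
      (g := φ) (μ := (volume : Measure (RN N))) (v := EuclideanSpace.single i 1)
      (by simp) (by simpa using! hc.integrable_of_hasCompactSupport hs)
      (by simpa using hφ.1.continuous.integrable_of_hasCompactSupport hφ.2.1)
      (by fun_prop) (fun x _ => hφ.1.differentiable (by simp) x)
    simpa [partialDeriv] using this
  · have : x ∉ tsupport (fderiv ℝ φ) := fun h => hx (hφ.2.2 (tsupport_fderiv_subset ℝ h))
    simp [partialDeriv, image_eq_zero_of_notMem_tsupport this]

/-- The constant functions as elements of `H¹(Ω)`. -/
noncomputable def H1.const {N : ℕ} {Ω : Set (RN N)}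
    [IsFiniteMeasure ((volume : Measure (RN N)).restrict Ω)] (c : ℝ) : H1 Ω :=
  ⟨WithLp.toLp 2 (Lp.const 2 _ c, 0), by
    intro φ hφ i
    have h1 : ∫ x in Ω, (Lp.const 2 ((volume : Measure (RN N)).restrict Ω) c) x
        * partialDeriv i φ x = 0 := by
      refine (integral_congr_ae (g := fun x => c * partialDeriv i φ x) ?_).trans ?_
      · filter_upwards [Lp.coeFn_const (p := 2) (μ := (volume : Measure (RN N)).restrict Ω) c]
          with x hx
        rw [hx, Function.const_apply]
      · rw [integral_const_mul, integral_partialDeriv_eq_zero hφ, mul_zero]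
    have h2 : ∫ x in Ω, (0 : L2Vec Ω) x i * φ x = 0 := by
      refine integral_eq_zero_of_ae ?_
      filter_upwards [Lp.coeFn_zero (RN N) 2 ((volume : Measure (RN N)).restrict Ω)] with x hx
      rw [hx]
      simp
    exact h1.trans (neg_eq_zero.mpr h2).symm⟩

/-- The Poincaré inequality for functions of mean zero. -/
theorem exists_norm_toL2_le_of_integral_eq_zero {N : ℕ} {Ω : Set (RN N)} (hΩ : IsDomainOfRN Ω)
    (hfin : volume Ω < ⊤) (hcomp : IsCompactOperator (H1.toL2 Ω)) :
    ∃ C : ℝ, 0 < C ∧ ∀ h : H1 Ω, ∫ x in Ω, H1.toL2 Ω h x = 0 →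
      ‖H1.toL2 Ω h‖ ≤ C * ‖H1.grad Ω h‖ := by
  have : IsFiniteMeasure ((volume : Measure (RN N)).restrict Ω) := ⟨by simpa using hfin⟩
  by_contra! hcon
  choose h hmean hlt using fun n : ℕ => hcon ((n : ℝ) + 1) (by positivity)
  have hpos : ∀ n, 0 < ‖H1.toL2 Ω (h n)‖ := fun n => lt_of_le_of_lt (by positivity) (hlt n)
  set k : ℕ → H1 Ω := fun n => ‖H1.toL2 Ω (h n)‖⁻¹ • h n with hk
  have hk1 : ∀ n, ‖H1.toL2 Ω (k n)‖ = 1 := fun n => by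
    simp only [hk, map_smul, norm_smul, norm_inv, norm_norm]
    exact inv_mul_cancel₀ (hpos n).ne'
  have hk2 : ∀ n, ‖H1.grad Ω (k n)‖ ≤ 1 / ((n : ℝ) + 1) := fun n => by
    simp only [hk, map_smul, norm_smul, norm_inv, norm_norm]
    rw [inv_mul_le_iff₀ (hpos n), mul_one_div, le_div_iff₀ (by positivity), mul_comm]
    exact (hlt n).le
  have hk3 : ∀ n, ∫ x in Ω, H1.toL2 Ω (k n) x * 1 = 0 := fun n => by
    calc ∫ x in Ω, H1.toL2 Ω (k n) x * 1
        = ∫ x in Ω, ‖H1.toL2 Ω (h n)‖⁻¹ * H1.toL2 Ω (h n) x := by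
          refine integral_congr_ae ?_
          simp only [hk, map_smul]
          filter_upwards [Lp.coeFn_smul ‖H1.toL2 Ω (h n)‖⁻¹ (H1.toL2 Ω (h n))] with x hx
          rw [hx]
          simp
      _ = 0 := by rw [integral_const_mul, hmean, mul_zero]
  -- The squared norm is at most `1 + 1`; any uniform bound suffices for compactness.
  have hk4 : ∀ n, ‖k n‖ ≤ 2 := fun n => by
    have hsq : ‖k n‖ ^ 2 = ‖H1.toL2 Ω (k n)‖ ^ 2 + ‖H1.grad Ω (k n)‖ ^ 2 :=
      WithLp.prod_norm_sq_eq_of_L2 (k n : WithLp 2 (L2 Ω × L2Vec Ω))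
    have h1 : 1 / ((n : ℝ) + 1) ≤ 1 := by
      rw [div_le_one (by positivity)]; linarith [n.cast_nonneg (α := ℝ)]
    have := (hk2 n).trans h1
    rw [hk1] at hsq
    nlinarith [norm_nonneg (H1.grad Ω (k n)), norm_nonneg (k n)]
  obtain ⟨K, hK, hKsub⟩ := IsCompactOperator.image_closedBall_subset_compact
    (f := (H1.toL2 Ω).toLinearMap) hcomp 2
  obtain ⟨u, -, ψ, hψ, hu⟩ := hK.tendsto_subseq (x := fun n => H1.toL2 Ω (k n))
    fun n => hKsub ⟨k n, by simpa using hk4 n, rfl⟩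
  have hg : Filter.Tendsto (fun n => H1.grad Ω (k (ψ n))) Filter.atTop (nhds 0) := by
    rw [tendsto_zero_iff_norm_tendsto_zero]
    exact squeeze_zero (fun _ => norm_nonneg _) (fun n => hk2 _)
      ((tendsto_one_div_add_atTop_nhds_zero_nat (𝕜 := ℝ)).comp hψ.tendsto_atTop)
  -- Compactness gives convergence in `L²` of a subsequence, and closedness gives its limit zero
  -- weak gradient.
  have hw := isWeakGradient_of_tendsto hu hg fun n => H1.isWeakGradient (k (ψ n))
  obtain ⟨c, hc⟩ := exists_ae_eq_const_of_isWeakGradient_zero hΩ hfin hw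
  have hint : ∫ x in Ω, u x * 1 = 0 := by
    refine tendsto_nhds_unique (tendsto_integral_mul hu (memLp_const 1)) ?_
    simp only [Function.comp_apply, hk3]
    exact tendsto_const_nhds
  have hvol : 0 < (volume : Measure (RN N)).real Ω :=
    ENNReal.toReal_pos (hΩ.1.measure_pos volume hΩ.2.nonempty).ne' hfin.ne
  have hc0 : c = 0 := by
    rw [integral_congr_ae (g := fun _ => c) (by filter_upwards [hc] with x hx; rw [hx, mul_one])]
      at hint
    simpa [hvol.ne'] using hint
  have hu0 : u = 0 := by
    refine Lp.ext ?_
    filter_upwards [hc, Lp.coeFn_zero ℝ 2 ((volume : Measure (RN N)).restrict Ω)] with x h1 h2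
    rw [h1, h2, hc0, Pi.zero_apply]
  have hnorm : ‖u‖ = 1 := tendsto_nhds_unique hu.norm (by simp [hk1])
  simp [hu0] at hnorm

theorem supportsPoincare_of_isCompactOperator {N : ℕ} {Ω : Set (RN N)} (hΩ : IsDomainOfRN Ω)
    (hfin : volume Ω < ⊤) (hcomp : IsCompactOperator (H1.toL2 Ω)) : SupportsPoincare Ω := by
  have : IsFiniteMeasure ((volume : Measure (RN N)).restrict Ω) := ⟨by simpa using hfin⟩
  obtain ⟨C, hC, H⟩ := exists_norm_toL2_le_of_integral_eq_zero hΩ hfin hcomp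
  have hvol : 0 < (volume : Measure (RN N)).real Ω :=
    ENNReal.toReal_pos (hΩ.1.measure_pos volume hΩ.2.nonempty).ne' hfin.ne
  refine ⟨C, hC, fun f => ?_⟩
  set m := meanOn Ω (H1.toL2 Ω f) with hm
  -- Subtracting the mean leaves the gradient unchanged and reduces to the mean-zero case.
  set h : H1 Ω := f - H1.const m with hh
  have hgrad : H1.grad Ω h = H1.grad Ω f := by
    have : H1.grad Ω (H1.const m) = 0 := rfl
    rw [hh, map_sub, this, sub_zero]
  have hae : (H1.toL2 Ω h : RN N → ℝ) =ᵐ[volume.restrict Ω] fun x => H1.toL2 Ω f x - m := by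
    have h1 : H1.toL2 Ω (H1.const m)
        = Lp.const 2 ((volume : Measure (RN N)).restrict Ω) m := rfl
    rw [hh, map_sub, h1]
    filter_upwards [Lp.coeFn_sub (H1.toL2 Ω f) (Lp.const 2 (volume.restrict Ω) m),
      Lp.coeFn_const (p := 2) (μ := (volume : Measure (RN N)).restrict Ω) m] with x h2 h3
    rw [h2, Pi.sub_apply, h3, Function.const_apply]
  have hmean : ∫ x in Ω, H1.toL2 Ω h x = 0 := by
    rw [integral_congr_ae hae, integral_sub ((Lp.memLp _).integrable (by norm_num))
      (integrable_const _)]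
    simp only [integral_const, measureReal_restrict_apply_univ, smul_eq_mul, hm, meanOn]
    field_simp
    ring
  have hnorm : normOn Ω 2 (fun x => H1.toL2 Ω f x - m) = normOn Ω 2 (H1.toL2 Ω h) :=
    (eLpNorm_congr_ae hae).symm
  rw [hnorm, normOn_two_coeFn, ← hgrad]
  exact ENNReal.ofReal_le_ofReal (H h hmean)

theorem proposition5p3 (N : ℕ) (hN : 1 ≤ N) (Ω : Set (RN N)) (hΩ : IsDomainOfRN Ω)
    (hfin : (volume : Measure (RN N)) Ω < ⊤) (hGNS : SupportsGNS Ω) :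
    IsCompactOperator (H1.toL2 Ω) ∧ SupportsPoincare Ω := by
  obtain ⟨q, C, hq, hC0, hC⟩ := hGNS.exists_embedding hN
  have hcomp := isCompactOperator_toL2 hΩ.1 hfin hq hC0 hC
  exact ⟨hcomp, supportsPoincare_of_isCompactOperator hΩ hfin hcomp⟩
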